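/- **Quantum minimax theorem for lower semicontinuous losses.** Let $\mathcal H$ be a complex Hilbert space, let $\Theta$ be a nonempty compact metric space and let $U$ be a compact metric space, both with their Borel $\sigma$-algebras. A density operator is a positive trace-class operator on $\mathcal H$ of trace one. Let $\rho$ be a map from $\Theta$ to the density operators on $\mathcal H$ that is - identifiable: $\rho(\theta_1)\neq\rho(\theta_2)$ whenever $\theta_1\neq\theta_2$; - regular: for every compact $K\subseteq\Theta$ one has $\lim_{\delta\downarrow 0}\omega_\rho(K_\delta)=0$, where $\omega_\rho(K_\delta)$ is the infimum of $\|X\|_1=\operatorname{Tr}|X|$ over all trace-class operators $X$ such that $-X\le\rho(\theta)-\rho(\eta)\le X$ for all $\theta,\eta\in K$ with $d(\theta,\eta)<\delta$. Let $w:\Theta\times U\to[0,+\infty]$ be an arbitrary lower semicontinuous function. Let $\mathrm{Po}(U)$ be the set of all POVMs on $U$, that is, of all maps $M$ from the Borel sets of $U$ to the positive bounded operators on $\mathcal H$ that are countably additive in the weak operator topology and satisfy $M(U)=I$. For $M\in\mathrm{Po}(U)$ put $$R_M(\theta)=\int_U w(\theta,u)\,\operatorname{Tr}\rho(\theta)M(du)\in[0,+\infty],\qquad\theta\in\Theta,$$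 where $\operatorname{Tr}\rho(\theta)M(du)$ denotes the probability measure $B\mapsto\operatorname{Tr}\rho(\theta)M(B)$. Let $\mathcal P(\Theta)$ be the set of all Borel probability measures on $\Theta$. Then $$\inf_{M\in\mathrm{Po}(U)}\ \sup_{\theta\in\Theta}R_M(\theta)\;=\;\sup_{\pi\in\mathcal P(\Theta)}\ \inf_{M\in\mathrm{Po}(U)}\int_\Theta R_M(\theta)\,\pi(d\theta).$$ -/

import Mathlib

open MeasureTheory Filter Topology
open scoped ENNReal InnerProductSpace

namespace QuantumDecision

section TraceClass

variable {H : Type*} [NormedAddCommGroup H] [InnerProductSpace ℂ H] [CompleteSpace H]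

variable (H) in
/-- The index set of a fixed Hilbert basis of `H`. -/
noncomputable def basisIndex : Set H := (exists_hilbertBasis ℂ H).choose

variable (H) in
/-- A fixed Hilbert basis of `H`. The trace and the trace norm are computed in it. -/
noncomputable def basis : HilbertBasis (basisIndex H) ℂ H :=
  (exists_hilbertBasis ℂ H).choose_spec.choose

/-- The trace norm `‖X‖₁ = Tr |X|`, where `|X| = (X* X) ^ (1 / 2)`; it is `∞` if `X` is not of
trace class. -/
noncomputable def traceNorm (X : H →L[ℂ] H) : ℝ≥0∞ :=
  ∑' i, ENNReal.ofReal (RCLike.re ⟪basis H i, CFC.abs X (basis H i)⟫_ℂ)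

/-- Trace-class operators. -/
def IsTraceClass (X : H →L[ℂ] H) : Prop := traceNorm X < ∞

/-- The trace of a trace-class operator. -/
noncomputable def trace (X : H →L[ℂ] H) : ℂ := ∑' i, ⟪basis H i, X (basis H i)⟫_ℂ

variable (H) in
/-- Density operators: positive trace-class operators of trace one. -/
@[ext]
structure DensityOperator where
  /-- The underlying bounded operator. -/
  op : H →L[ℂ] H
  isTraceClass : IsTraceClass op
  nonneg : 0 ≤ op
  trace_eq_one : trace op = 1

end TraceClass

section Regular

variable {H : Type*} [NormedAddCommGroup H] [InnerProductSpace ℂ H] [CompleteSpace H]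
variable {Θ : Type*} [PseudoMetricSpace Θ]

/-- `ω_T(K_δ)`: the infimum of `‖X‖₁` over the trace-class operators `X` that satisfy
`-X ≤ T θ - T η ≤ X` for all `θ, η ∈ K` with `d(θ, η) < δ` (`∞` if there is no such `X`). -/
noncomputable def modulus (T : Θ → H →L[ℂ] H) (K : Set Θ) (δ : ℝ) : ℝ≥0∞ :=
  ⨅ X ∈ {X : H →L[ℂ] H | IsTraceClass X ∧
    ∀ θ ∈ K, ∀ η ∈ K, dist θ η < δ → -X ≤ T θ - T η ∧ T θ - T η ≤ X}, traceNorm X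

/-- Regularity of an operator-valued function: `ω_T(K_δ) → 0` as `δ → 0`, for every compact `K`. -/
def IsRegularMap (T : Θ → H →L[ℂ] H) : Prop :=
  ∀ K : Set Θ, IsCompact K → Tendsto (fun δ : ℝ => modulus T K δ) (𝓝[>] 0) (𝓝 0)

end Regular

section POVM

/-- A positive-operator-valued measure on `U` with values in the bounded operators of `H`.
As for Mathlib's vector measures, the value at a non-measurable set is `0` by convention. -/
structure POVM (H : Type*) [NormedAddCommGroup H] [InnerProductSpace ℂ H] [CompleteSpace H]
    (U : Type*) [MeasurableSpace U] where
  /-- The operator attached to a set. -/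
  op : Set U → H →L[ℂ] H
  op_of_not_measurableSet : ∀ B : Set U, ¬ MeasurableSet B → op B = 0
  nonneg : ∀ B : Set U, MeasurableSet B → 0 ≤ op B
  /-- Countable additivity in the weak operator topology. -/
  hasSum_iUnion : ∀ B : ℕ → Set U, (∀ j, MeasurableSet (B j)) →
    Pairwise (Function.onFun Disjoint B) →
    ∀ x y : H, HasSum (fun j => ⟪x, op (B j) y⟫_ℂ) ⟪x, op (⋃ j, B j) y⟫_ℂ
  op_univ : op Set.univ = 1

end POVM

section BornMeasure

variable {H : Type*} [NormedAddCommGroup H] [InnerProductSpace ℂ H] [CompleteSpace H]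
variable {U : Type*} [MeasurableSpace U]

set_option linter.unusedSectionVars false in
theorem hasSum_sq_norm_inner {ι : Type*} (b : HilbertBasis ι ℂ H) (x : H) :
    HasSum (fun i => ‖⟪b i, x⟫_ℂ‖ ^ 2) (‖x‖ ^ 2) := by
  have h := (b.hasSum_inner_mul_inner x x).mapL (RCLike.reCLM (K := ℂ))
  have h2 : (fun i => ‖⟪b i, x⟫_ℂ‖ ^ 2)
      = fun i => (RCLike.reCLM (K := ℂ)) (⟪x, b i⟫_ℂ * ⟪b i, x⟫_ℂ) := by
    funext i
    rw [← inner_conj_symm x (b i), RCLike.conj_mul]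
    simp [← Complex.ofReal_pow]
  rw [h2]
  have h3 : ‖x‖ ^ 2 = (RCLike.reCLM (K := ℂ)) ⟪x, x⟫_ℂ := (inner_self_eq_norm_sq (𝕜 := ℂ) x).symm
  rw [h3]
  exact h

/-- The Hilbert--Schmidt square sums of an operator and of its adjoint, in any two Hilbert bases,
are both the square sum of the matrix entries. -/
theorem summable_sq_entries {ι κ : Type*} (b : HilbertBasis ι ℂ H) (c : HilbertBasis κ ℂ H)
    (T : H →L[ℂ] H) (hT : Summable fun i => ‖T (b i)‖ ^ 2) :
    Summable fun p : ι × κ => ‖⟪c p.2, T (b p.1)⟫_ℂ‖ ^ 2 := by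
  rw [summable_prod_of_nonneg (fun p => by positivity)]
  refine ⟨fun i => (hasSum_sq_norm_inner c (T (b i))).summable, ?_⟩
  simpa only [(hasSum_sq_norm_inner c (T (b _))).tsum_eq] using hT

theorem summable_sq_adjoint {ι κ : Type*} (b : HilbertBasis ι ℂ H) (c : HilbertBasis κ ℂ H)
    (T : H →L[ℂ] H) (hT : Summable fun i => ‖T (b i)‖ ^ 2) :
    Summable fun j => ‖T.adjoint (c j)‖ ^ 2 := by
  have h := (summable_sq_entries b c T hT).prod_symm
  have h2 := ((summable_prod_of_nonneg (fun p => by positivity)).1 h).2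
  refine h2.congr fun j => ?_
  rw [← (hasSum_sq_norm_inner b (T.adjoint (c j))).tsum_eq]
  refine tsum_congr fun i => ?_
  change ‖⟪c j, T (b i)⟫_ℂ‖ ^ 2 = _
  rw [ContinuousLinearMap.adjoint_inner_right, norm_inner_symm]

/-- If `S` is a self-adjoint Hilbert--Schmidt operator and `A` is bounded, then
`Tr S S A = Tr S A S`, each side computed in a Hilbert basis of its own. -/
theorem hasSum_trace_mul {ι κ : Type*} (b : HilbertBasis ι ℂ H) (c : HilbertBasis κ ℂ H)
    (S A : H →L[ℂ] H) (hS : IsSelfAdjoint S) (hb : Summable fun i => ‖S (b i)‖ ^ 2) :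
    Summable (fun j => ⟪S (c j), A (S (c j))⟫_ℂ) ∧
    HasSum (fun i => ⟪b i, S (S (A (b i)))⟫_ℂ) (∑' j, ⟪S (c j), A (S (c j))⟫_ℂ) := by
  have hadj : S.adjoint = S := hS.adjoint_eq
  have hc : Summable fun j => ‖S (c j)‖ ^ 2 := by
    simpa only [hadj] using summable_sq_adjoint b c S hb
  have hAc : Summable fun j => ‖(A.adjoint ∘L S) (c j)‖ ^ 2 := by
    refine Summable.of_nonneg_of_le (fun j => by positivity) (fun j => ?_)
      (hc.mul_left (‖A.adjoint‖ ^ 2))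
    rw [← mul_pow]
    exact pow_le_pow_left₀ (norm_nonneg _) (A.adjoint.le_opNorm _) 2
  have sym : ∀ x y, ⟪S x, y⟫_ℂ = ⟪x, S y⟫_ℂ := fun x y => by
    conv_lhs => rw [← hadj]
    rw [ContinuousLinearMap.adjoint_inner_left]
  have h1 := summable_sq_entries b c S hb
  have h2 := (summable_sq_entries c b (A.adjoint ∘L S) hAc).prod_symm
  have hF : Summable fun p : ι × κ =>
      ⟪S (b p.1), c p.2⟫_ℂ * ⟪c p.2, S (A (b p.1))⟫_ℂ := by
    refine Summable.of_norm_bounded (h1.add h2) fun p => ?_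
    have e1 : ‖⟪S (b p.1), c p.2⟫_ℂ‖ = ‖⟪c p.2, S (b p.1)⟫_ℂ‖ := norm_inner_symm _ _
    have e2 : ‖⟪c p.2, S (A (b p.1))⟫_ℂ‖ = ‖⟪b p.1, (A.adjoint ∘L S) (c p.2)⟫_ℂ‖ := by
      rw [← sym, ContinuousLinearMap.comp_apply, ContinuousLinearMap.adjoint_inner_right,
        norm_inner_symm]
    rw [norm_mul, e1, e2]
    simp only [Prod.swap]
    nlinarith [sq_nonneg (‖⟪c p.2, S (b p.1)⟫_ℂ‖ - ‖⟪b p.1, (A.adjoint ∘L S) (c p.2)⟫_ℂ‖),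
      sq_nonneg (‖⟪c p.2, S (b p.1)⟫_ℂ‖ + ‖⟪b p.1, (A.adjoint ∘L S) (c p.2)⟫_ℂ‖)]
  have hrow : ∀ i, HasSum (fun j => ⟪S (b i), c j⟫_ℂ * ⟪c j, S (A (b i))⟫_ℂ)
      ⟪b i, S (S (A (b i)))⟫_ℂ := fun i => by
    rw [← sym]; exact c.hasSum_inner_mul_inner _ _
  have hcol : ∀ j, HasSum (fun i => ⟪S (b i), c j⟫_ℂ * ⟪c j, S (A (b i))⟫_ℂ)
      ⟪S (c j), A (S (c j))⟫_ℂ := fun j => by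
    have h := b.hasSum_inner_mul_inner (A.adjoint (S (c j))) (S (c j))
    rw [ContinuousLinearMap.adjoint_inner_left] at h
    refine h.congr_fun fun i => ?_
    rw [ContinuousLinearMap.adjoint_inner_left, sym, sym, mul_comm]
  have hS1 := hF.hasSum.prod_fiberwise hrow
  have hS2 := (hF.prod_symm.hasSum).prod_fiberwise hcol
  refine ⟨hS2.summable, ?_⟩
  have e := hF.hasSum.unique ((Equiv.prodComm κ ι).hasSum_iff.1 hF.prod_symm.hasSum)
  rw [hS2.tsum_eq]
  convert hS1 using 1
  exact e.symm

theorem isSelfAdjoint_sqrt (A : H →L[ℂ] H) : IsSelfAdjoint (CFC.sqrt A) :=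
  (CFC.sqrt_nonneg A).isSelfAdjoint

theorem sqrt_apply_sqrt_apply {A : H →L[ℂ] H} (hA : 0 ≤ A) (x : H) :
    CFC.sqrt A (CFC.sqrt A x) = A x := by
  change (CFC.sqrt A * CFC.sqrt A) x = A x
  rw [CFC.sqrt_mul_sqrt_self A hA]

theorem inner_eq_norm_sqrt_sq {A : H →L[ℂ] H} (hA : 0 ≤ A) (x : H) :
    ⟪x, A x⟫_ℂ = ((‖CFC.sqrt A x‖ ^ 2 : ℝ) : ℂ) := by
  rw [← sqrt_apply_sqrt_apply hA]
  conv_lhs => rw [← (isSelfAdjoint_sqrt A).adjoint_eq]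
  rw [ContinuousLinearMap.adjoint_inner_right, (isSelfAdjoint_sqrt A).adjoint_eq]
  simp [inner_self_eq_norm_sq_to_K]

/-- The square root of a density operator is a Hilbert--Schmidt operator. -/
theorem DensityOperator.summable_sqrt (ρ : DensityOperator H) :
    Summable fun i => ‖CFC.sqrt ρ.op (basis H i)‖ ^ 2 := by
  have h := ρ.isTraceClass
  rw [IsTraceClass, traceNorm, CFC.abs_of_nonneg ρ.op ρ.nonneg] at h
  simp only [inner_eq_norm_sqrt_sq ρ.nonneg, RCLike.re_to_complex, Complex.ofReal_re] at h
  have h2 := ENNReal.summable_toReal h.ne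
  refine h2.congr fun i => ?_
  rw [ENNReal.toReal_ofReal (by positivity)]

/-- `Tr ρ A = Tr ρ^(1/2) A ρ^(1/2)`; in particular the series that defines `Tr ρ A` converges. -/
theorem DensityOperator.hasSum_trace (ρ : DensityOperator H) (A : H →L[ℂ] H) :
    Summable (fun j => ⟪CFC.sqrt ρ.op (basis H j), A (CFC.sqrt ρ.op (basis H j))⟫_ℂ) ∧
    HasSum (fun i => ⟪basis H i, (ρ.op ∘L A) (basis H i)⟫_ℂ)
      (∑' j, ⟪CFC.sqrt ρ.op (basis H j), A (CFC.sqrt ρ.op (basis H j))⟫_ℂ) := by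
  have h := hasSum_trace_mul (basis H) (basis H) (CFC.sqrt ρ.op) A (isSelfAdjoint_sqrt _)
    ρ.summable_sqrt
  simpa only [sqrt_apply_sqrt_apply ρ.nonneg, ContinuousLinearMap.comp_apply] using h

set_option linter.unusedSectionVars false in
theorem re_inner_nonneg {A : H →L[ℂ] H} (hA : 0 ≤ A) (x : H) : 0 ≤ (⟪x, A x⟫_ℂ).re :=
  (ContinuousLinearMap.nonneg_iff_isPositive A).1 hA |>.re_inner_nonneg_right x

theorem DensityOperator.ofReal_trace (ρ : DensityOperator H) {A : H →L[ℂ] H} (hA : 0 ≤ A) :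
    ENNReal.ofReal (trace (ρ.op ∘L A)).re = ∑' j, ENNReal.ofReal
      (⟪CFC.sqrt ρ.op (basis H j), A (CFC.sqrt ρ.op (basis H j))⟫_ℂ).re := by
  obtain ⟨h1, h2⟩ := ρ.hasSum_trace A
  rw [trace, h2.tsum_eq, Complex.re_tsum h1,
    ENNReal.ofReal_tsum_of_nonneg (fun j => re_inner_nonneg hA _) (Complex.hasSum_re h1.hasSum).summable]

theorem POVM.op_empty (M : POVM H U) : M.op ∅ = 0 := by
  refine ContinuousLinearMap.ext fun y => ext_inner_left ℂ fun x => ?_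
  have h := M.hasSum_iUnion (fun _ => ∅) (fun _ => MeasurableSet.empty)
    (fun _ _ _ => disjoint_bot_left) x y
  simpa using (summable_const_iff _).1 h.summable

/-- The distribution `B ↦ Tr ρ M(B)` of the outcome of the measurement `M` in the state `ρ`. -/
noncomputable def bornMeasure (ρ : DensityOperator H) (M : POVM H U) : Measure U :=
  Measure.ofMeasurable (fun B _ => ENNReal.ofReal (trace (ρ.op ∘L M.op B)).re)
    (by simp [M.op_empty, trace])
    (by
      intro B hB hd
      rw [ρ.ofReal_trace (M.nonneg _ (MeasurableSet.iUnion hB))]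
      simp only [fun i => ρ.ofReal_trace (M.nonneg _ (hB i))]
      rw [ENNReal.tsum_comm]
      refine tsum_congr fun j => ?_
      have h := Complex.hasSum_re (M.hasSum_iUnion B hB hd (CFC.sqrt ρ.op (basis H j))
        (CFC.sqrt ρ.op (basis H j)))
      rw [← h.tsum_eq, ENNReal.ofReal_tsum_of_nonneg
        (fun i => re_inner_nonneg (M.nonneg _ (hB i)) _) h.summable])

open scoped ComplexOrder in
/-- The Born rule. -/
theorem bornMeasure_apply (ρ : DensityOperator H) (M : POVM H U) {B : Set U}
    (hB : MeasurableSet B) :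
    bornMeasure ρ M B ≠ ∞ ∧ ((bornMeasure ρ M B).toReal : ℂ) = trace (ρ.op ∘L M.op B) := by
  rw [bornMeasure, Measure.ofMeasurable_apply _ hB]
  refine ⟨ENNReal.ofReal_ne_top, ?_⟩
  obtain ⟨h1, h2⟩ := ρ.hasSum_trace (M.op B)
  have hpos := (ContinuousLinearMap.nonneg_iff_isPositive _).1 (M.nonneg B hB)
  have h0 : 0 ≤ trace (ρ.op ∘L M.op B) := by
    rw [trace, h2.tsum_eq]
    exact tsum_nonneg fun j => hpos.inner_nonneg_right _
  rw [ENNReal.toReal_ofReal (Complex.le_def.1 h0).1]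
  exact Complex.ext rfl (Complex.le_def.1 h0).2

end BornMeasure

section Risk

variable {H : Type*} [NormedAddCommGroup H] [InnerProductSpace ℂ H] [CompleteSpace H]
variable {Θ U : Type*} [MeasurableSpace U]

/-- The risk function `R_M(θ) = ∫ w(θ, u) Tr ρ(θ) M(du)`. -/
noncomputable def risk (ρ : Θ → DensityOperator H) (w : Θ × U → ℝ≥0∞) (M : POVM H U) (θ : Θ) :
    ℝ≥0∞ :=
  ∫⁻ u, w (θ, u) ∂(bornMeasure (ρ θ) M)

end Risk

end QuantumDecision

/-! Averages are at most suprema, so only `≤` needs work. Two facts carry it: the POVMs form a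
compact set, and for finitely many bounded continuous losses the minimax statement is a separation
theorem in a finite-dimensional space.

A POVM `M` is encoded by the finite measures `M.vec x`, that is, `B ↦ ⟪x, M(B) x⟫`. The families
that arise are exactly the quadratic ones of mass `‖x‖ ^ 2` (`POVM.isQuadratic_vec`,
`exists_povm_vec_eq`). These conditions survive convex combinations and weak limits, and on a
compact space measures of bounded mass are weakly compact; hence `exists_povm_tendsto_vec`.

Each `w (θ, ·)` is an increasing limit of bounded Lipschitz functions, so "risk at most `c`
everywhere" is a family of conditions indexed by `(θ, n)`, each stable under limits
(`lintegral_bornMeasure_le_of_tendsto`). By compactness it is enough to meet finitely many of them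
at once. If that failed, a separating functional, once normalised, would be a finitely supported
prior of Bayes risk at least `c` (`exists_forall_lt_of_forall_stdSimplex`). -/

open scoped NNReal BoundedContinuousFunction

namespace QuantumDecision

/-! ### Approximation of lower semicontinuous losses from below -/

section LowerSemicontinuous

variable {U : Type*} [PseudoMetricSpace U]

/-- The `n`-Lipschitz envelope of the truncation of `g` at height `n`. -/
noncomputable def lipschitzEnvelope (g : U → ℝ≥0∞) (n : ℕ) (u : U) : ℝ≥0 :=
  ⨅ v, (min (g v) n).toNNReal + n * nndist u v

theorem lipschitzEnvelope_le (g : U → ℝ≥0∞) (n : ℕ) (u v : U) :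
    lipschitzEnvelope g n u ≤ (min (g v) n).toNNReal + n * nndist u v :=
  ciInf_le (OrderBot.bddBelow _) v

theorem lipschitzWith_lipschitzEnvelope (g : U → ℝ≥0∞) (n : ℕ) :
    LipschitzWith n (lipschitzEnvelope g n) := by
  have key : ∀ x y, lipschitzEnvelope g n x ≤ lipschitzEnvelope g n y + n * nndist x y := by
    intro x y
    have : Nonempty U := ⟨x⟩
    rw [← tsub_le_iff_right]
    refine le_ciInf fun v => ?_
    rw [tsub_le_iff_right]
    refine (lipschitzEnvelope_le g n x v).trans ?_
    rw [add_assoc, ← mul_add, add_comm (nndist y v)]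
    gcongr
    exact nndist_triangle x y v
  refine LipschitzWith.of_dist_le_mul fun x y => ?_
  rw [NNReal.dist_eq, abs_sub_le_iff]
  have h1 := NNReal.coe_le_coe.2 (key x y)
  have h2 := NNReal.coe_le_coe.2 (key y x)
  rw [nndist_comm] at h2
  push_cast at h1 h2 ⊢
  constructor <;> linarith

theorem lipschitzEnvelope_mono (g : U → ℝ≥0∞) (u : U) :
    Monotone fun n => lipschitzEnvelope g n u := by
  intro m n hmn
  have : Nonempty U := ⟨u⟩
  refine ciInf_mono (OrderBot.bddBelow _) fun v => ?_
  have : (m : ℝ≥0∞) ≤ n := by exact_mod_cast hmn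
  gcongr
  · simp

theorem coe_lipschitzEnvelope_le (g : U → ℝ≥0∞) (n : ℕ) (u : U) :
    (lipschitzEnvelope g n u : ℝ≥0∞) ≤ g u := by
  refine (ENNReal.coe_le_coe.2 (lipschitzEnvelope_le g n u u)).trans ?_
  rw [nndist_self, mul_zero, add_zero, ENNReal.coe_toNNReal (by simp)]
  exact min_le_left _ _

/-- A lower semicontinuous function is the supremum of its Lipschitz envelopes. -/
theorem iSup_lipschitzEnvelope {g : U → ℝ≥0∞} (hg : LowerSemicontinuous g) (u : U) :
    ⨆ n, (lipschitzEnvelope g n u : ℝ≥0∞) = g u := by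
  refine le_antisymm (iSup_le fun n => coe_lipschitzEnvelope_le g n u) ?_
  refine le_of_forall_lt fun c hc => ?_
  obtain ⟨d, hcd, hd⟩ := ENNReal.lt_iff_exists_nnreal_btwn.1 hc
  obtain ⟨δ, hδ, hball⟩ := Metric.eventually_nhds_iff.1 (hg u d hd)
  lift δ to ℝ≥0 using hδ.le
  -- `n ≥ d` keeps the truncation above `d` inside the ball; `n * δ ≥ d` makes the distance penalty
  -- alone reach `d` outside it.
  obtain ⟨n, hn⟩ := exists_nat_ge (max d (d / δ))
  have hnd : d ≤ n := (le_max_left _ _).trans hn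
  have hnδ : d ≤ n * δ := by
    rw [← div_le_iff₀ (by exact_mod_cast hδ)]
    exact (le_max_right _ _).trans hn
  refine hcd.trans_le (le_iSup_of_le n (ENNReal.coe_le_coe.2 ?_))
  have : Nonempty U := ⟨u⟩
  refine le_ciInf fun v => ?_
  by_cases hv : dist v u < δ
  · refine le_add_right ?_
    rw [← ENNReal.coe_le_coe, ENNReal.coe_toNNReal (by simp)]
    exact le_min (hball hv).le (by exact_mod_cast hnd)
  · refine le_add_left (hnδ.trans ?_)
    gcongr
    rw [nndist_comm]
    exact NNReal.coe_le_coe.1 (not_lt.1 hv)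

/-- The Lipschitz envelope as a bounded continuous function. -/
noncomputable def boundedEnvelope [CompactSpace U] (g : U → ℝ≥0∞) (n : ℕ) : U →ᵇ ℝ≥0 :=
  BoundedContinuousFunction.mkOfCompact ⟨_, (lipschitzWith_lipschitzEnvelope g n).continuous⟩

theorem lintegral_eq_iSup_boundedEnvelope [CompactSpace U] [MeasurableSpace U] [BorelSpace U]
    {g : U → ℝ≥0∞} (hg : LowerSemicontinuous g) (μ : Measure U) :
    ∫⁻ u, g u ∂μ = ⨆ n, ∫⁻ u, boundedEnvelope g n u ∂μ := by
  rw [← lintegral_iSup]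
  · exact lintegral_congr fun u => (iSup_lipschitzEnvelope hg u).symm
  · exact fun n => ((boundedEnvelope g n).continuous.measurable).coe_nnreal_ennreal
  · exact fun m n hmn u => ENNReal.coe_le_coe.2 (lipschitzEnvelope_mono g u hmn)

end LowerSemicontinuous

/-! ### Finite minimax by Hahn–Banach separation -/

section FiniteMinimax

/-- If every convex combination of finitely many convex functions takes a value below `c`, then
these functions are simultaneously below `c` at some point. -/
theorem exists_forall_lt_of_forall_stdSimplex {X ι : Type*} [Nonempty X] [Fintype ι]
    (r : X → ι → ℝ)
    (hr : ∀ x y, ∀ a b : ℝ, 0 ≤ a → 0 ≤ b → a + b = 1 → ∃ z, ∀ i, r z i ≤ a * r x i + b * r y i)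
    (c : ℝ) (h : ∀ p ∈ stdSimplex ℝ ι, ∃ x, ∑ i, p i * r x i < c) :
    ∃ x, ∀ i, r x i < c := by
  classical
  by_contra! hcon
  -- The strict upper set of the range of `r` is open and convex; the conclusion says that it
  -- contains the constant vector `c`.
  set C : Set (ι → ℝ) := {y | ∃ x, ∀ i, r x i < y i} with hC
  have hopen : IsOpen C := by
    have : C = ⋃ x, ⋂ i, {y | r x i < y i} := by ext; simp [hC]
    rw [this]
    exact isOpen_iUnion fun x => isOpen_iInter_of_finite fun i =>
      isOpen_lt continuous_const (continuous_apply i)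
  have hconv : Convex ℝ C := by
    rintro y ⟨x, hx⟩ y' ⟨x', hx'⟩ a b ha hb hab
    obtain ⟨z, hz⟩ := hr x x' a b ha hb hab
    refine ⟨z, fun i => (hz i).trans_lt ?_⟩
    simp only [Pi.add_apply, Pi.smul_apply, smul_eq_mul]
    rcases ha.eq_or_lt with rfl | ha
    · have : b = 1 := by linarith
      subst this; simpa using hx' i
    · nlinarith [hx i, hx' i, mul_lt_mul_of_pos_left (hx i) ha,
        mul_le_mul_of_nonneg_left (hx' i).le hb]
  have hcC : (fun _ => c) ∉ C := fun ⟨x, hx⟩ => by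
    obtain ⟨i, hi⟩ := hcon x
    exact absurd (hx i) (not_lt.2 hi)
  obtain ⟨f, hf⟩ := geometric_hahn_banach_point_open hconv hopen hcC
  set l : ι → ℝ := fun i => f (Pi.single i 1) with hl
  have hfl : ∀ y, f y = ∑ i, l i * y i := fun y => by
    conv_lhs => rw [pi_eq_sum_univ' y, map_sum]
    refine Finset.sum_congr rfl fun i _ => ?_
    rw [map_smul, smul_eq_mul, mul_comm]
  -- The separation is tested at `r x + ε + v`: a large `v` forces `l ≥ 0`, while `v = 0` gives `∑ l
  -- > 0` and the final contradiction.
  have hup : ∀ x, ∀ ε : ℝ, 0 < ε → ∀ v : ι → ℝ, (∀ i, 0 ≤ v i) →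
      c * ∑ i, l i < ∑ i, l i * r x i + ε * ∑ i, l i + ∑ i, l i * v i := fun x ε hε v hv => by
    have h1 := hf (fun i => r x i + ε + v i) ⟨x, fun i => by linarith [hv i]⟩
    rw [hfl, hfl, ← Finset.sum_mul] at h1
    simp only [mul_add, Finset.sum_add_distrib, ← Finset.sum_mul] at h1
    linarith
  have hl0 : ∀ i, 0 ≤ l i := fun i => by
    by_contra! hi
    obtain ⟨x⟩ := ‹Nonempty X›
    set K := ∑ i, l i * r x i + 1 * ∑ i, l i - c * ∑ i, l i with hK
    -- This `v` pairs with `l` to `-|K|`, so `hup` becomes `0 < K - |K|`.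
    have hv := hup x 1 one_pos (Pi.single i (|K| / -l i)) fun j => by
      by_cases hj : j = i
      · subst hj
        simp only [Pi.single_eq_same]
        exact div_nonneg (abs_nonneg _) (by linarith)
      · simp [hj]
    have he : ∑ j, l j * (Pi.single i (|K| / -l i) : ι → ℝ) j = -|K| := by
      have : l i * (|K| / -l i) = -|K| := by
        rw [div_neg, mul_neg, mul_div_cancel₀ _ hi.ne]
      simp [Pi.single_apply, this]
    rw [he] at hv
    linarith [le_abs_self K]
  have hS : 0 < ∑ i, l i := by
    refine (Finset.sum_nonneg fun i _ => hl0 i).lt_of_ne fun h0 => ?_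
    have hz := (Finset.sum_eq_zero_iff_of_nonneg fun i _ => hl0 i).1 h0.symm
    obtain ⟨x⟩ := ‹Nonempty X›
    have := hup x 1 one_pos 0 (by simp)
    rw [← h0, Finset.sum_eq_zero (fun i hi => by rw [hz i hi, zero_mul])] at this
    simp at this
  obtain ⟨x, hx⟩ := h (fun i => l i / ∑ i, l i) ⟨fun i => div_nonneg (hl0 i) hS.le, by
    rw [← Finset.sum_div, div_self hS.ne']⟩
  simp only [div_mul_eq_mul_div] at hx
  rw [← Finset.sum_div, div_lt_iff₀ hS] at hx
  -- This `ε` closes the gap exactly, and `hup` becomes a strict inequality between equal numbers.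
  have := hup x ((c * ∑ i, l i - ∑ i, l i * r x i) / ∑ i, l i)
    (div_pos (by linarith) hS) 0 (by simp)
  rw [div_mul_cancel₀ _ hS.ne'] at this
  simp at this

end FiniteMinimax

/-! ### Quadratic forms, also with values in cones such as the finite measures -/

section QuadraticForm

variable {H : Type*} [NormedAddCommGroup H] [InnerProductSpace ℂ H]

/-- The identities that a (vector-valued) quadratic form `x ↦ ⟪x, T x⟫` on a complex space
satisfies and that characterise it, written without subtraction. -/
structure IsQuadratic {E : Type*} [AddCommMonoid E] [Module ℝ≥0 E] (q : H → E) : Prop where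
  add : ∀ x y z, q (x + y + z) + q (x - y) + q (x - z) = q (x - y - z) + q (x + y) + q (x + z)
  smul : ∀ (c : ℝ≥0) (x y), q (((c : ℝ) : ℂ) • x + y) + c • q (x - y)
    = q (((c : ℝ) : ℂ) • x - y) + c • q (x + y)
  norm_smul : ∀ (c : ℂ) (x), q (c • x) = (‖c‖₊ ^ 2) • q x

theorem IsQuadratic.map {E F : Type*} [AddCommMonoid E] [Module ℝ≥0 E] [AddCommMonoid F]
    [Module ℝ≥0 F] {q : H → E} (hq : IsQuadratic q) (φ : E →ₗ[ℝ≥0] F) :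
    IsQuadratic fun x => φ (q x) where
  add x y z := by simp only [← map_add, hq.add]
  smul c x y := by simp only [← map_add, ← map_smul, hq.smul]
  norm_smul c x := by rw [← map_smul, hq.norm_smul]

theorem IsQuadratic.combination {E : Type*} [AddCommMonoid E] [Module ℝ≥0 E] {q q' : H → E}
    (hq : IsQuadratic q) (hq' : IsQuadratic q') (a b : ℝ≥0) :
    IsQuadratic fun x => a • q x + b • q' x where
  add x y z := by
    have h := congrArg₂ (fun s t => a • s + b • t) (hq.add x y z) (hq'.add x y z)
    simp only [smul_add] at h
    convert h using 1 <;> abel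
  smul c x y := by
    have h := congrArg₂ (fun s t => a • s + b • t) (hq.smul c x y) (hq'.smul c x y)
    simp only [smul_add, smul_comm a c, smul_comm b c] at h ⊢
    convert h using 1 <;> abel
  norm_smul c x := by
    rw [hq.norm_smul, hq'.norm_smul, smul_add, smul_comm a, smul_comm b]

theorem isQuadratic_inner (T : H →L[ℂ] H) : IsQuadratic fun x => (⟪x, T x⟫_ℂ).re where
  add x y z := by
    simp only [map_add, map_sub, inner_add_left, inner_add_right, inner_sub_left, inner_sub_right,
      Complex.add_re, Complex.sub_re]
    ring
  smul c x y := by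
    simp only [map_add, map_sub, map_smul, inner_add_left, inner_add_right, inner_sub_left,
      inner_sub_right, Complex.add_re, Complex.sub_re, inner_smul_left, inner_smul_right,
      Complex.conj_ofReal, Complex.re_ofReal_mul, NNReal.smul_def, smul_eq_mul]
    ring
  norm_smul c x := by
    simp only [map_smul, inner_smul_left, inner_smul_right, NNReal.smul_def, smul_eq_mul]
    rw [← mul_assoc, RCLike.mul_conj, NNReal.coe_pow, coe_nnnorm]
    norm_cast
    exact Complex.re_ofReal_mul _ _

namespace IsQuadratic

/-- The real polar form of a quadratic form. -/
noncomputable def polar (q : H → ℝ) (x y : H) : ℝ := (q (x + y) - q (x - y)) / 4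

variable {q : H → ℝ}

theorem map_neg (hq : IsQuadratic q) (x : H) : q (-x) = q x := by
  simpa using hq.norm_smul (-1) x

theorem polar_comm (hq : IsQuadratic q) (x y : H) : polar q x y = polar q y x := by
  rw [polar, polar, add_comm x y, ← neg_sub y x, hq.map_neg]

theorem polar_neg_right {H : Type*} [NormedAddCommGroup H] {q : H → ℝ} (x y : H) : polar q x (-y) = -polar q x y := by
  simp only [polar, sub_neg_eq_add, ← sub_eq_add_neg]; ring

theorem polar_neg_left (hq : IsQuadratic q) (x y : H) : polar q (-x) y = -polar q x y := by
  rw [hq.polar_comm, polar_neg_right, hq.polar_comm]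

/-- The field `add` is this identity with its negative terms moved across; `smul` plays the same
role for nonnegative real scalars. -/
theorem polar_add_right (hq : IsQuadratic q) (x y z : H) :
    polar q x (y + z) = polar q x y + polar q x z := by
  have := hq.add x y z
  simp only [polar, ← add_assoc, ← sub_sub]
  linarith

theorem polar_smul_left (hq : IsQuadratic q) (c : ℝ) (x y : H) :
    polar q ((c : ℂ) • x) y = c * polar q x y := by
  have key : ∀ (c : ℝ≥0) (x : H), polar q (((c : ℝ) : ℂ) • x) y = c * polar q x y := fun c x => by
    have := hq.smul c x y
    simp only [NNReal.smul_def, smul_eq_mul] at this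
    simp only [polar]
    linarith
  rcases le_total 0 c with hc | hc
  · exact key ⟨c, hc⟩ x
  · have := key (-c).toNNReal (-x)
    rw [Real.coe_toNNReal _ (by linarith), Complex.ofReal_neg, neg_smul, smul_neg, neg_neg, hq.polar_neg_left] at this
    linarith

theorem polar_smul_right (hq : IsQuadratic q) (c : ℝ) (x y : H) :
    polar q x ((c : ℂ) • y) = c * polar q x y := by
  rw [hq.polar_comm, hq.polar_smul_left, hq.polar_comm]

/-- This invariance makes the real polar form the real part of a sesquilinear form. -/
theorem polar_I_smul (hq : IsQuadratic q) (x y : H) :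
    polar q (Complex.I • x) (Complex.I • y) = polar q x y := by
  simp only [polar, ← smul_add, ← smul_sub, hq.norm_smul]
  simp

theorem polar_I_smul_right (hq : IsQuadratic q) (x y : H) :
    polar q x (Complex.I • y) = -polar q (Complex.I • x) y := by
  rw [← hq.polar_I_smul x, smul_smul, Complex.I_mul_I, neg_one_smul, polar_neg_right]

theorem polar_self (hq : IsQuadratic q) (x : H) : polar q x x = q x := by
  have h2 := hq.norm_smul 2 x
  have h0 := hq.norm_smul 0 x
  rw [two_smul] at h2
  simp only [zero_smul, nnnorm_zero, ne_eq, OfNat.ofNat_ne_zero, not_false_eq_true, zero_pow] at h0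
  rw [polar, sub_self, h0, h2, NNReal.smul_def]
  simp
  ring

/-- For unit vectors, `|q (u + v) - q (u - v)|` is at most `‖u + v‖ ^ 2 + ‖u - v‖ ^ 2 = 4` by the
parallelogram law; homogeneity gives the rest. -/
theorem abs_polar_le (hq : IsQuadratic q) (h0 : ∀ x, 0 ≤ q x) (h1 : ∀ x, q x ≤ ‖x‖ ^ 2) (x y : H) :
    |polar q x y| ≤ ‖x‖ * ‖y‖ := by
  have hunit : ∀ u v : H, ‖u‖ = 1 → ‖v‖ = 1 → |polar q u v| ≤ 1 := fun u v hu hv => by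
    have hp := parallelogram_law_with_norm ℂ u v
    rw [hu, hv] at hp
    rw [polar, abs_le]
    constructor <;> nlinarith [h0 (u + v), h0 (u - v), h1 (u + v), h1 (u - v)]
  rcases eq_or_ne x 0 with rfl | hx
  · simpa using hq.polar_smul_left 0 0 y
  rcases eq_or_ne y 0 with rfl | hy
  · simpa using hq.polar_smul_right 0 x 0
  have hx' : ‖x‖ ≠ 0 := norm_ne_zero_iff.2 hx
  have hy' : ‖y‖ ≠ 0 := norm_ne_zero_iff.2 hy
  have hex : x = (‖x‖ : ℂ) • ((‖x‖⁻¹ : ℝ) : ℂ) • x := by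
    rw [smul_smul, ← Complex.ofReal_mul, mul_inv_cancel₀ hx', Complex.ofReal_one, one_smul]
  have hey : y = (‖y‖ : ℂ) • ((‖y‖⁻¹ : ℝ) : ℂ) • y := by
    rw [smul_smul, ← Complex.ofReal_mul, mul_inv_cancel₀ hy', Complex.ofReal_one, one_smul]
  have hn : ∀ z : H, ‖z‖ ≠ 0 → ‖((‖z‖⁻¹ : ℝ) : ℂ) • z‖ = 1 := fun z hz => by
    rw [_root_.norm_smul, Complex.norm_real, norm_inv, norm_norm, inv_mul_cancel₀ hz]
  have hu := hunit _ _ (hn x hx') (hn y hy')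
  calc |polar q x y|
      = |polar q ((‖x‖ : ℂ) • ((‖x‖⁻¹ : ℝ) : ℂ) • x) ((‖y‖ : ℂ) • ((‖y‖⁻¹ : ℝ) : ℂ) • y)| := by
        rw [← hex, ← hey]
    _ = ‖x‖ * ‖y‖ * |polar q (((‖x‖⁻¹ : ℝ) : ℂ) • x) (((‖y‖⁻¹ : ℝ) : ℂ) • y)| := by
        rw [hq.polar_smul_left, hq.polar_smul_right, abs_mul, abs_mul, abs_norm, abs_norm, mul_assoc]
    _ ≤ ‖x‖ * ‖y‖ := mul_le_of_le_one_right (by positivity) hu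

/-- The complex polar form of a quadratic form. -/
noncomputable def complexPolar (q : H → ℝ) (x y : H) : ℂ :=
  ⟨polar q x y, polar q (Complex.I • x) y⟩

/-- The first slot is conjugate-linear, so the imaginary part at `(x, y)` has to be the real part at
`(I • x, y)`. -/
theorem complexPolar_smul_right (hq : IsQuadratic q) (c : ℂ) (x y : H) :
    complexPolar q x (c • y) = c * complexPolar q x y := by
  have hc : c • y = (c.re : ℂ) • y + (c.im : ℂ) • Complex.I • y := by
    rw [smul_smul, ← add_smul, Complex.re_add_im]
  have hII : Complex.I • Complex.I • x = -x := by rw [smul_smul, Complex.I_mul_I, neg_one_smul]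
  apply Complex.ext <;>
  simp only [complexPolar, hc, hq.polar_add_right, hq.polar_smul_right, hq.polar_I_smul_right,
    Complex.mul_re, Complex.mul_im, hII, hq.polar_neg_left] <;> ring

theorem complexPolar_conj (hq : IsQuadratic q) (x y : H) :
    starRingEnd ℂ (complexPolar q x y) = complexPolar q y x := by
  apply Complex.ext
  · exact hq.polar_comm x y
  · simp only [complexPolar, Complex.conj_im]
    rw [hq.polar_comm _ x, hq.polar_I_smul_right]

theorem complexPolar_add_right (hq : IsQuadratic q) (x y z : H) :
    complexPolar q x (y + z) = complexPolar q x y + complexPolar q x z := by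
  apply Complex.ext <;> simp [complexPolar, hq.polar_add_right]

theorem complexPolar_self (hq : IsQuadratic q) (x : H) : complexPolar q x x = q x := by
  apply Complex.ext
  · simp [complexPolar, hq.polar_self]
  · have h := hq.polar_I_smul_right x x
    rw [hq.polar_comm] at h
    simp only [complexPolar, Complex.ofReal_im]
    linarith

/-- A quadratic form between `0` and `‖x‖ ^ 2` is the form of a positive bounded operator. -/
theorem exists_operator [CompleteSpace H] (hq : IsQuadratic q) (h0 : ∀ x, 0 ≤ q x)
    (h1 : ∀ x, q x ≤ ‖x‖ ^ 2) :
    ∃ T : H →L[ℂ] H, 0 ≤ T ∧ ∀ x, ⟪x, T x⟫_ℂ = q x := by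
  let s : H →ₗ⋆[ℂ] H →ₗ[ℂ] ℂ := LinearMap.mk₂'ₛₗ (starRingEnd ℂ) (RingHom.id ℂ) (complexPolar q)
    (fun x y z => by
      rw [← hq.complexPolar_conj, hq.complexPolar_add_right, map_add, hq.complexPolar_conj,
        hq.complexPolar_conj])
    (fun c x y => by
      rw [← hq.complexPolar_conj, hq.complexPolar_smul_right, map_mul, hq.complexPolar_conj]; rfl)
    hq.complexPolar_add_right (fun c x y => hq.complexPolar_smul_right c x y)
  -- The constant `2` counts the real and the imaginary part, each at most `‖x‖ * ‖y‖`.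
  let B : H →L⋆[ℂ] H →L[ℂ] ℂ := s.mkContinuous₂ 2 fun x y => by
    refine (Complex.norm_le_abs_re_add_abs_im _).trans ?_
    have e1 := hq.abs_polar_le h0 h1 x y
    have e2 := hq.abs_polar_le h0 h1 (Complex.I • x) y
    rw [_root_.norm_smul, Complex.norm_I, one_mul] at e2
    change |polar q x y| + |polar q (Complex.I • x) y| ≤ _
    linarith
  have hT : ∀ x, ⟪InnerProductSpace.continuousLinearMapOfBilin B x, x⟫_ℂ = q x := fun x => by
    rw [InnerProductSpace.continuousLinearMapOfBilin_apply]
    exact hq.complexPolar_self x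
  refine ⟨InnerProductSpace.continuousLinearMapOfBilin B, ?_, fun x => ?_⟩
  · rw [ContinuousLinearMap.nonneg_iff_isPositive, ContinuousLinearMap.isPositive_iff_complex]
    intro x
    rw [hT]
    exact ⟨by simp, by simpa using h0 x⟩
  · rw [← inner_conj_symm, hT, Complex.conj_ofReal]

end IsQuadratic

end QuadraticForm

/-! ### POVMs as quadratic families of finite measures -/

section

variable {H : Type*} [NormedAddCommGroup H] [InnerProductSpace ℂ H]
variable {U : Type*} [MeasurableSpace U]

/-- A quadratic family of finite measures takes quadratic values on every set. -/
theorem IsQuadratic.apply_set {μ : H → FiniteMeasure U} (hμ : IsQuadratic μ) (B : Set U) :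
    IsQuadratic fun x => (μ x B : ℝ) :=
  hμ.map (φ :=
    { toFun := fun ν => (ν B : ℝ)
      map_add' := fun ν ν' => by simp
      map_smul' := fun c ν => by simp [NNReal.smul_def] })

theorem hasSum_apply_iUnion (μ : FiniteMeasure U) (B : ℕ → Set U) (hB : ∀ j, MeasurableSet (B j))
    (hd : Pairwise (Function.onFun Disjoint B)) :
    HasSum (fun j => (μ (B j) : ℝ)) (μ (⋃ j, B j)) := by
  have h : (μ : Measure U) (⋃ j, B j) = ∑' j, (μ : Measure U) (B j) := measure_iUnion hd hB
  have hfin : ∑' j, (μ : Measure U) (B j) ≠ ∞ := h ▸ measure_ne_top _ _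
  have h2 := ENNReal.hasSum_toReal hfin
  rw [← ENNReal.tsum_toReal_eq (fun j => measure_ne_top _ _), ← h] at h2
  exact h2

/-- Carries weak countable additivity from the diagonal to all pairs. Positivity enters only through
the symmetry of `T`. -/
theorem inner_polarization {T : H →L[ℂ] H} (hT : 0 ≤ T) (x y : H) :
    ⟪x, T y⟫_ℂ = (⟪y + x, T (y + x)⟫_ℂ - ⟪y - x, T (y - x)⟫_ℂ
      + Complex.I * ⟪y + Complex.I • x, T (y + Complex.I • x)⟫_ℂ
      - Complex.I * ⟪y - Complex.I • x, T (y - Complex.I • x)⟫_ℂ) / 4 := by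
  have hs : ∀ u v, ⟪u, T v⟫_ℂ = ⟪T u, v⟫_ℂ := fun u v =>
    (((ContinuousLinearMap.nonneg_iff_isPositive T).1 hT).isSymmetric u v).symm
  simp only [hs]
  exact inner_map_polarization (T : H →ₗ[ℂ] H) y x

end

variable {H : Type*} [NormedAddCommGroup H] [InnerProductSpace ℂ H] [CompleteSpace H]
variable {U : Type*} [MeasurableSpace U]

/-- The measure `B ↦ ⟪x, M(B) x⟫`. -/
noncomputable def POVM.vectorMeasure (M : POVM H U) (x : H) : Measure U :=
  Measure.ofMeasurable (fun B _ => ENNReal.ofReal (⟪x, M.op B x⟫_ℂ).re)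
    (by simp [M.op_empty])
    (by
      intro B hB hd
      have h := Complex.hasSum_re (M.hasSum_iUnion B hB hd x x)
      rw [← h.tsum_eq, ENNReal.ofReal_tsum_of_nonneg
        (fun i => re_inner_nonneg (M.nonneg _ (hB i)) _) h.summable])

theorem POVM.vectorMeasure_apply (M : POVM H U) (x : H) {B : Set U} (hB : MeasurableSet B) :
    M.vectorMeasure x B = ENNReal.ofReal (⟪x, M.op B x⟫_ℂ).re :=
  Measure.ofMeasurable_apply _ hB

/-- The finite measure `B ↦ ⟪x, M(B) x⟫`. -/
noncomputable def POVM.vec (M : POVM H U) (x : H) : FiniteMeasure U :=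
  ⟨M.vectorMeasure x, ⟨by
    rw [M.vectorMeasure_apply x MeasurableSet.univ]; exact ENNReal.ofReal_lt_top⟩⟩

theorem POVM.vec_apply (M : POVM H U) (x : H) {B : Set U} (hB : MeasurableSet B) :
    (M.vec x B : ℝ) = (⟪x, M.op B x⟫_ℂ).re := by
  change (M.vectorMeasure x B).toReal = _
  rw [M.vectorMeasure_apply x hB, ENNReal.toReal_ofReal (re_inner_nonneg (M.nonneg B hB) x)]

theorem POVM.mass_vec (M : POVM H U) (x : H) : (M.vec x).mass = ‖x‖₊ ^ 2 := by
  refine NNReal.eq ?_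
  rw [FiniteMeasure.mass, M.vec_apply x MeasurableSet.univ, M.op_univ]
  simpa using inner_self_eq_norm_sq (𝕜 := ℂ) x

theorem POVM.isQuadratic_vec (M : POVM H U) : IsQuadratic M.vec := by
  have key : ∀ B, MeasurableSet B → ∀ x, (M.vec x B : ℝ) = (⟪x, M.op B x⟫_ℂ).re :=
    fun B hB x => M.vec_apply x hB
  refine ⟨fun x y z => ?_, fun c x y => ?_, fun c x => ?_⟩ <;>
  refine FiniteMeasure.eq_of_forall_apply_eq _ _ fun B hB => NNReal.eq ?_
  · simpa [key B hB] using (isQuadratic_inner (M.op B)).add x y z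
  · simpa [key B hB, NNReal.smul_def, mul_add] using (isQuadratic_inner (M.op B)).smul c x y
  · have := (isQuadratic_inner (M.op B)).norm_smul c x
    rw [NNReal.smul_def] at this
    rw [FiniteMeasure.smul_apply, smul_eq_mul, NNReal.coe_mul, key B hB, key B hB, this, smul_eq_mul]

/-- A quadratic family of finite measures of masses `‖x‖ ^ 2` comes from a POVM. -/
theorem exists_povm_vec_eq {μ : H → FiniteMeasure U} (hμ : IsQuadratic μ)
    (hmass : ∀ x, (μ x).mass = ‖x‖₊ ^ 2) : ∃ M : POVM H U, ∀ x, M.vec x = μ x := by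
  -- The form `x ↦ μ x B` is bounded by the mass `‖x‖ ^ 2`, hence comes from an operator; the value
  -- `0` off the measurable sets is the convention of `POVM`.
  have hex : ∀ B : Set U, ∃ T : H →L[ℂ] H, 0 ≤ T ∧ (¬ MeasurableSet B → T = 0) ∧
      (MeasurableSet B → ∀ x, ⟪x, T x⟫_ℂ = ((μ x B : ℝ) : ℂ)) := fun B => by
    by_cases hB : MeasurableSet B
    · obtain ⟨T, hT, h⟩ := (hμ.apply_set B).exists_operator (fun x => NNReal.coe_nonneg _)
        (fun x => by
          have h := (μ x).apply_le_mass B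
          rw [hmass] at h
          exact_mod_cast h)
      exact ⟨T, hT, fun h' => absurd hB h', fun _ => h⟩
    · exact ⟨0, le_rfl, fun _ => rfl, fun h => absurd h hB⟩
  choose T hT0 hTn hT using hex
  refine ⟨⟨T, hTn, fun B _ => hT0 B, fun B hB hd x y => ?_, ?_⟩, fun x => ?_⟩
  · have hdiag : ∀ z : H, HasSum (fun j => ⟪z, T (B j) z⟫_ℂ) ⟪z, T (⋃ j, B j) z⟫_ℂ := fun z => by
      simp only [hT _ (MeasurableSet.iUnion hB), fun j => hT _ (hB j)]
      exact Complex.hasSum_ofReal.2 (hasSum_apply_iUnion (μ z) B hB hd)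
    simp only [inner_polarization (hT0 _) x y]
    exact ((((hdiag _).sub (hdiag _)).add ((hdiag _).mul_left _)).sub
      ((hdiag _).mul_left _)).div_const 4
  · refine ContinuousLinearMap.coe_inj.1 ((ext_inner_map _ _).1 fun x => ?_)
    change ⟪T Set.univ x, x⟫_ℂ = ⟪x, x⟫_ℂ
    have h : ⟪x, T Set.univ x⟫_ℂ = ((‖x‖ ^ 2 : ℝ) : ℂ) := by
      rw [hT _ MeasurableSet.univ]
      have h' : (μ x) Set.univ = ‖x‖₊ ^ 2 := hmass x
      rw [h']
      simp
    rw [← inner_conj_symm, h]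
    simp [inner_self_eq_norm_sq_to_K]
  · refine FiniteMeasure.eq_of_forall_apply_eq _ _ fun B hB => NNReal.eq ?_
    rw [POVM.vec_apply _ x hB]
    simp only [hT B hB, Complex.ofReal_re]

theorem exists_povm_mixture (M N : POVM H U) {a b : ℝ≥0} (hab : a + b = 1) :
    ∃ P : POVM H U, ∀ x, P.vec x = a • M.vec x + b • N.vec x := by
  refine exists_povm_vec_eq (M.isQuadratic_vec.combination N.isQuadratic_vec a b) fun x => ?_
  have hM : M.vec x Set.univ = ‖x‖₊ ^ 2 := M.mass_vec x
  have hN : N.vec x Set.univ = ‖x‖₊ ^ 2 := N.mass_vec x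
  rw [FiniteMeasure.mass, FiniteMeasure.coeFn_add, Pi.add_apply, FiniteMeasure.smul_apply,
    FiniteMeasure.smul_apply, hM, hN, ← add_smul, hab, one_smul]

/-! ### Compactness of the set of POVMs -/

/-- Every ultrafilter on the POVMs of a compact space has a limit. -/
theorem exists_povm_tendsto_vec [TopologicalSpace U] [T2Space U] [CompactSpace U] [BorelSpace U]
    [HasOuterApproxClosed U] (F : Ultrafilter (POVM H U)) :
    ∃ M : POVM H U, ∀ x, Tendsto (fun N : POVM H U => N.vec x) F (𝓝 (M.vec x)) := by
  have hlim : ∀ x, ∃ ν : FiniteMeasure U, Tendsto (fun N : POVM H U => N.vec x) F (𝓝 ν) := by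
    intro x
    obtain ⟨ν, -, hν⟩ := (isCompact_setOfPred_finiteMeasure_le_of_compactSpace U
      (‖x‖₊ ^ 2)).ultrafilter_le_nhds (F.map fun N : POVM H U => N.vec x)
      (by
        rw [le_principal_iff, Ultrafilter.mem_coe, Ultrafilter.mem_map]
        exact Filter.univ_mem' fun N => by simp [N.mass_vec])
    exact ⟨ν, hν⟩
  choose μ hμ using hlim
  -- Both sides of each identity are weakly continuous and weak limits are unique, so the identities
  -- pass to the limit.
  have hq : IsQuadratic μ := by
    refine ⟨fun x y z => ?_, fun c x y => ?_, fun c x => ?_⟩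
    · refine tendsto_nhds_unique (((hμ _).add (hμ _)).add (hμ _))
        ((((hμ _).add (hμ _)).add (hμ _)).congr fun N => (N.isQuadratic_vec.add x y z).symm)
    · refine tendsto_nhds_unique ((hμ _).add ((hμ _).const_smul c))
        (((hμ _).add ((hμ _).const_smul c)).congr fun N => (N.isQuadratic_vec.smul c x y).symm)
    · exact tendsto_nhds_unique (hμ _)
        (((hμ _).const_smul _).congr fun N => (N.isQuadratic_vec.norm_smul c x).symm)
  -- No mass is lost, since the total mass is weakly continuous.
  obtain ⟨M, hM⟩ := exists_povm_vec_eq hq fun x =>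
    tendsto_nhds_unique (hμ x).mass (tendsto_const_nhds.congr fun N => (N.mass_vec x).symm)
  exact ⟨M, fun x => (hM x).symm ▸ hμ x⟩

/-! ### Risks as functions of the POVM -/

/-- This is `Tr ρ M(B) = Tr ρ^(1/2) M(B) ρ^(1/2)`, expanded in the fixed basis. It transfers facts
about `M.vec` to risks. -/
theorem bornMeasure_eq_sum (ρ : DensityOperator H) (M : POVM H U) :
    bornMeasure ρ M = Measure.sum fun j => (M.vec (CFC.sqrt ρ.op (basis H j)) : Measure U) := by
  ext B hB
  rw [Measure.sum_apply _ hB, bornMeasure, Measure.ofMeasurable_apply _ hB,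
    ρ.ofReal_trace (M.nonneg B hB)]
  exact tsum_congr fun j => (M.vectorMeasure_apply _ hB).symm

theorem lintegral_bornMeasure (ρ : DensityOperator H) (M : POVM H U) (f : U → ℝ≥0∞) :
    ∫⁻ u, f u ∂(bornMeasure ρ M)
      = ∑' j, ∫⁻ u, f u ∂(M.vec (CFC.sqrt ρ.op (basis H j)) : Measure U) := by
  rw [bornMeasure_eq_sum, lintegral_sum_measure]

theorem bornMeasure_univ (ρ : DensityOperator H) (M : POVM H U) :
    bornMeasure ρ M Set.univ = 1 := by
  obtain ⟨h1, h2⟩ := bornMeasure_apply ρ M MeasurableSet.univ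
  rw [M.op_univ, ContinuousLinearMap.one_def, ContinuousLinearMap.comp_id, ρ.trace_eq_one] at h2
  rw [← ENNReal.ofReal_toReal h1]
  norm_cast at h2
  simp [h2]

theorem lintegral_bornMeasure_ne_top [TopologicalSpace U] [OpensMeasurableSpace U]
    (ρ : DensityOperator H) (M : POVM H U) (f : U →ᵇ ℝ≥0) :
    ∫⁻ u, f u ∂(bornMeasure ρ M) ≠ ∞ := by
  have : IsFiniteMeasure (bornMeasure ρ M) := ⟨by simp [bornMeasure_univ]⟩
  exact (f.lintegral_lt_top_of_nnreal _).ne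

theorem exists_povm_lintegral_mixture (M N : POVM H U) {a b : ℝ≥0} (hab : a + b = 1) :
    ∃ P : POVM H U, ∀ (ρ : DensityOperator H) (f : U → ℝ≥0∞),
      ∫⁻ u, f u ∂(bornMeasure ρ P)
        = a * ∫⁻ u, f u ∂(bornMeasure ρ M) + b * ∫⁻ u, f u ∂(bornMeasure ρ N) := by
  obtain ⟨P, hP⟩ := exists_povm_mixture M N hab
  refine ⟨P, fun ρ f => ?_⟩
  simp only [lintegral_bornMeasure, hP, FiniteMeasure.toMeasure_add, FiniteMeasure.toMeasure_smul,
    lintegral_add_measure, lintegral_smul_measure]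
  rw [ENNReal.tsum_add]
  simp only [ENNReal.smul_def, smul_eq_mul, ENNReal.tsum_mul_left]

/-- Sublevel sets of `M ↦ ∫ f d(Tr ρ M)` are closed under limits of ultrafilters. -/
theorem lintegral_bornMeasure_le_of_tendsto [TopologicalSpace U] [OpensMeasurableSpace U]
    {F : Filter (POVM H U)} [F.NeBot]
    {M : POVM H U} (hM : ∀ x, Tendsto (fun N : POVM H U => N.vec x) F (𝓝 (M.vec x)))
    (ρ : DensityOperator H) (f : U →ᵇ ℝ≥0) {c : ℝ≥0∞}
    (hc : ∀ᶠ N in F, ∫⁻ u, f u ∂(bornMeasure ρ N) ≤ c) :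
    ∫⁻ u, f u ∂(bornMeasure ρ M) ≤ c := by
  rw [lintegral_bornMeasure]
  -- Only finite partial sums pass to the limit; as the terms are nonnegative, each stays below `c`.
  refine ENNReal.summable.tsum_le_of_sum_le fun s => ?_
  refine le_of_tendsto (tendsto_finsetSum s fun j _ =>
    FiniteMeasure.tendsto_iff_forall_lintegral_tendsto.1 (hM _) f) (hc.mono fun N hN => ?_)
  rw [lintegral_bornMeasure] at hN
  exact (ENNReal.sum_le_tsum s).trans hN

/-- Finitely many risks of bounded continuous losses. -/
theorem exists_povm_forall_lintegral_lt {ι : Type*} [Fintype ι] [Nonempty (POVM H U)]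
    [TopologicalSpace U] [OpensMeasurableSpace U]
    (ρ : ι → DensityOperator H) (f : ι → U →ᵇ ℝ≥0) (c : ℝ≥0)
    (h : ∀ p ∈ stdSimplex ℝ ι, ∃ M : POVM H U,
      ∑ i, ENNReal.ofReal (p i) * ∫⁻ u, f i u ∂(bornMeasure (ρ i) M) < c) :
    ∃ M : POVM H U, ∀ i, ∫⁻ u, f i u ∂(bornMeasure (ρ i) M) < c := by
  -- Bounded losses have finite risks, so separation in `ι → ℝ` applies.
  have hfin := fun i M => lintegral_bornMeasure_ne_top (ρ i) M (f i)
  obtain ⟨M, hM⟩ := exists_forall_lt_of_forall_stdSimplex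
    (fun (M : POVM H U) i => (∫⁻ u, f i u ∂(bornMeasure (ρ i) M)).toReal)
    (fun M N a b ha hb hab => by
      lift a to ℝ≥0 using ha
      lift b to ℝ≥0 using hb
      obtain ⟨P, hP⟩ := exists_povm_lintegral_mixture M N (a := a) (b := b) (by exact_mod_cast hab)
      refine ⟨P, fun i => ?_⟩
      rw [hP, ENNReal.toReal_add (ENNReal.mul_ne_top ENNReal.coe_ne_top (hfin i M))
        (ENNReal.mul_ne_top ENNReal.coe_ne_top (hfin i N))]
      simp) c
    (fun p hp => by
      obtain ⟨M, hM⟩ := h p hp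
      refine ⟨M, ?_⟩
      have h2 := ENNReal.toReal_strict_mono ENNReal.coe_ne_top hM
      rw [ENNReal.toReal_sum fun i _ => ENNReal.mul_ne_top ENNReal.ofReal_ne_top (hfin i M)] at h2
      simpa [ENNReal.toReal_mul, ENNReal.toReal_ofReal (hp.1 _)] using h2)
  exact ⟨M, fun i => (ENNReal.toReal_lt_toReal (hfin i M) ENNReal.coe_ne_top).1 (hM i)⟩

/-- The finitely supported probability measure with weights `p` at the points `θ i`. -/
theorem exists_probabilityMeasure_lintegral_eq {Θ : Type*} [MeasurableSpace Θ] [MeasurableSingletonClass Θ]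
    {ι : Type*} [Fintype ι] (θ : ι → Θ) {p : ι → ℝ} (hp : p ∈ stdSimplex ℝ ι) :
    ∃ π : ProbabilityMeasure Θ, ∀ g : Θ → ℝ≥0∞,
      ∫⁻ t, g t ∂(π : Measure Θ) = ∑ i, ENNReal.ofReal (p i) * g (θ i) := by
  refine ⟨⟨∑ i, ENNReal.ofReal (p i) • Measure.dirac (θ i), ⟨?_⟩⟩, fun g => ?_⟩
  · simp only [Measure.coe_finsetSum, Finset.sum_apply, Measure.smul_apply, measure_univ,
      smul_eq_mul, mul_one]
    rw [← ENNReal.ofReal_sum_of_nonneg fun i _ => hp.1 i, hp.2, ENNReal.ofReal_one]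
  · simp

end QuantumDecision

/-! ### The minimax theorem -/

open QuantumDecision in
theorem theorem3
    {H : Type*} [NormedAddCommGroup H] [InnerProductSpace ℂ H] [CompleteSpace H]
    {Θ : Type*} [MetricSpace Θ] [CompactSpace Θ] [Nonempty Θ] [MeasurableSpace Θ] [BorelSpace Θ]
    {U : Type*} [MetricSpace U] [CompactSpace U] [MeasurableSpace U] [BorelSpace U]
    (ρ : Θ → QuantumDecision.DensityOperator H)
    (hρ_inj : Function.Injective ρ)
    (hρ_reg : QuantumDecision.IsRegularMap fun θ => (ρ θ).op)
    (w : Θ × U → ℝ≥0∞) (hw : LowerSemicontinuous w) :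
    ⨅ M : QuantumDecision.POVM H U, ⨆ θ : Θ, QuantumDecision.risk ρ w M θ
      = ⨆ π : ProbabilityMeasure Θ, ⨅ M : QuantumDecision.POVM H U,
          ∫⁻ θ, QuantumDecision.risk ρ w M θ ∂(π : Measure Θ) := by
  refine le_antisymm ?_ ?_
  · refine le_of_forall_gt_imp_ge_of_dense fun c hc => ?_
    induction c with
    | top => exact le_top
    | coe c =>
    have hprior : ∀ π : ProbabilityMeasure Θ, ∃ M : POVM H U,
        ∫⁻ θ, risk ρ w M θ ∂(π : Measure Θ) < c := fun π =>
      iInf_lt_iff.1 ((le_iSup (fun π : ProbabilityMeasure Θ => ⨅ M : POVM H U,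
        ∫⁻ θ, risk ρ w M θ ∂(π : Measure Θ)) π).trans_lt hc)
    -- Without POVMs every Bayes infimum would be `∞`, against the finite bound `c`.
    have hne : Nonempty (POVM H U) := by
      obtain ⟨θ⟩ := ‹Nonempty Θ›
      obtain ⟨M, -⟩ := hprior ⟨Measure.dirac θ, inferInstance⟩
      exact ⟨M⟩
    have hwθ : ∀ θ, LowerSemicontinuous fun u => w (θ, u) := fun θ =>
      hw.comp (by fun_prop : Continuous fun u => (θ, u))
    have hrisk : ∀ M θ, risk ρ w M θ
        = ⨆ n, ∫⁻ u, boundedEnvelope (fun u => w (θ, u)) n u ∂(bornMeasure (ρ θ) M) :=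
      fun M θ => lintegral_eq_iSup_boundedEnvelope (hwθ θ) _
    let A : Θ × ℕ → Set (POVM H U) := fun k =>
      {M | ∫⁻ u, boundedEnvelope (fun u => w (k.1, u)) k.2 u ∂(bornMeasure (ρ k.1) M) ≤ c}
    have hA : ∀ s : Finset (Θ × ℕ), (⋂ k ∈ s, A k).Nonempty := fun s => by
      obtain ⟨M, hM⟩ := exists_povm_forall_lintegral_lt (H := H) (U := U) (ι := s)
        (fun k => ρ k.1.1) (fun k => boundedEnvelope (fun u => w (k.1.1, u)) k.1.2) c
        (fun p hp => by
          -- The weights on pairs `(θ, n)` are pushed forward to a prior on `Θ`; replacing `w` by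
          -- its envelopes only lowers the risk.
          obtain ⟨π, hπ⟩ := exists_probabilityMeasure_lintegral_eq (fun k : s => k.1.1) hp
          obtain ⟨M, hM⟩ := hprior π
          refine ⟨M, lt_of_le_of_lt (Finset.sum_le_sum fun k _ => ?_) (hπ _ ▸ hM)⟩
          gcongr
          rw [hrisk]
          exact le_iSup (fun n => ∫⁻ u, boundedEnvelope (fun u => w (k.1.1, u)) n u
            ∂(bornMeasure (ρ k.1.1) M)) k.1.2)
      exact ⟨M, Set.mem_iInter₂.2 fun k hk => (hM ⟨k, hk⟩).le⟩
    have : (⨅ k, 𝓟 (A k)).NeBot := by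
      refine (hasBasis_iInf_principal_finite A).neBot_iff.2 fun {t} ht => ?_
      simpa using hA ht.toFinset
    -- This ultrafilter contains every `A k`, so its limit satisfies all the conditions at once.
    obtain ⟨M, hM⟩ := exists_povm_tendsto_vec (Ultrafilter.of (⨅ k, 𝓟 (A k)))
    refine iInf_le_of_le M (iSup_le fun θ => ?_)
    rw [hrisk]
    refine iSup_le fun n => lintegral_bornMeasure_le_of_tendsto hM (ρ θ) _ ?_
    exact (Ultrafilter.of_le _).trans (iInf_le _ (θ, n)) (mem_principal_self _)
  · refine iSup_le fun π => le_iInf fun M => iInf_le_of_le M ?_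
    calc ∫⁻ θ, risk ρ w M θ ∂(π : Measure Θ)
        ≤ ∫⁻ _, (⨆ θ, risk ρ w M θ) ∂(π : Measure Θ) :=
          lintegral_mono fun θ => le_iSup (risk ρ w M) θ
      _ = ⨆ θ, risk ρ w M θ := by simp
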